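/- Let $X$ and $Y$ be complex Hilbert spaces, let $A:D(A)\subset X\to X$ be the (closed, densely defined) generator of a strongly continuous semigroup on $X$, let $C\in L(X,Y)$ and $Q=C^*C$. Write $\sigma(A)$ for the spectrum of $A$, $\sigma^+(A)=\sigma(A)\cap\{\operatorname{Re}s\ge 0\}$ and $\sigma^-(A)=\sigma(A)\cap\{\operatorname{Re}s<0\}$. Suppose that $A$ satisfies the spectral decomposition assumption: $\sigma^+(A)$ is bounded and there is a rectifiable simple closed curve $\Gamma$ that has $\sigma^+(A)$ in its interior and $\sigma^-(A)$ in its exterior. Let $$\mathcal P=\frac1{2\pi i}\int_\Gamma (sI-A)^{-1}\,ds$$ ($\Gamma$ traversed once in the positive direction) be the spectral projection, and put $X_u=\mathcal P X$, $X_s=(I-\mathcal P)X$. Suppose further that * the restriction $A_s$ of $A$ to $X_s$ is exponentially stable, i.e. it generates a strongly continuous semigroup $(T_s(t))_{t\ge0}$ on $X_s$ with $\|T_s(t)\|\le Me^{-\omega t}$ for all $t\ge 0$, for some $M$ and some $\omega>0$; * $\sigma^+(A)$ consists of finitely many eigenvalues of $A$, each of finite order, i.e. for each $\lambda\in\sigma^+(A)$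 there is $\nu\in\mathbb N$ such that $\lim_{s\to\lambda}(s-\lambda)^{\nu}(sI-A)^{-1}x$ exists for every $x\in X$; * $X_u$ is orthogonal to $X_s$. If $(A,C)$ is exponentially detectable, i.e. there is $L\in L(Y,X)$ such that $A+LC$ (with domain $D(A)$) generates an exponentially stable strongly continuous semigroup on $X$, then there are a self-adjoint operator $P\in L(X,X)$ that is positive ($\langle Px,x\rangle>0$ for all $x\ne0$) and a constant $m>0$ such that $P$ maps $D(A)$ into $D(A^*)$ and $$\langle (Q-A^*P-PA)x,x\rangle\ \ge\ m\|x\|^2\qquad\text{for all }x\in D(A).$$ -/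

import Mathlib

open Set Filter Topology

noncomputable section

/-! ### Strongly continuous semigroups, generators, exponential stability -/

/-- `T` restricted to `[0, ∞)` is a strongly continuous semigroup of bounded operators on `E`.
The values `T t` for `t < 0` are irrelevant. -/
structure IsC0Semigroup {E : Type*} [NormedAddCommGroup E] [NormedSpace ℂ E]
    (T : ℝ → E →L[ℂ] E) : Prop where
  map_zero : T 0 = ContinuousLinearMap.id ℂ E
  map_add : ∀ s t : ℝ, 0 ≤ s → 0 ≤ t → T (s + t) = (T s).comp (T t)
  continuousOn : ∀ x : E, ContinuousOn (fun t : ℝ => T t x) (Ici 0)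

/-- `A` is the infinitesimal generator of `T`: we have `x ∈ D(A)` and `A x = y` if and only if
`(T t x - x) / t → y` as `t ↓ 0`. -/
def IsGenerator {E : Type*} [NormedAddCommGroup E] [NormedSpace ℂ E]
    (A : E →ₗ.[ℂ] E) (T : ℝ → E →L[ℂ] E) : Prop :=
  ∀ x y : E, (x, y) ∈ A.graph ↔
    Tendsto (fun t : ℝ => ((t : ℂ)⁻¹) • (T t x - x)) (𝓝[>] 0) (𝓝 y)

/-- `A` generates a strongly continuous semigroup `T` with `‖T t‖ ≤ M e^{-ω t}` for all `t ≥ 0`,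
for some `M` and some `ω > 0`. -/
def IsExponentiallyStable {E : Type*} [NormedAddCommGroup E] [NormedSpace ℂ E]
    (A : E →ₗ.[ℂ] E) : Prop :=
  ∃ T : ℝ → E →L[ℂ] E, IsC0Semigroup T ∧ IsGenerator A T ∧
    ∃ M ω : ℝ, 0 < ω ∧ ∀ t : ℝ, 0 ≤ t → ‖T t‖ ≤ M * Real.exp (-ω * t)

/-- `(A, C)` is exponentially detectable: there is a bounded output injection `L` such that
`A + L C`, with domain `D(A)`, generates an exponentially stable semigroup. -/
def IsExponentiallyDetectable {X Y : Type*} [NormedAddCommGroup X] [NormedSpace ℂ X]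
    [NormedAddCommGroup Y] [NormedSpace ℂ Y] (A : X →ₗ.[ℂ] X) (C : X →L[ℂ] Y) : Prop :=
  ∃ L : Y →L[ℂ] X, IsExponentiallyStable ((L.comp C : X →ₗ[ℂ] X) +ᵥ A)

/-! ### Spectrum and resolvent of an unbounded operator -/

namespace LinearPMap

variable {E : Type*} [NormedAddCommGroup E] [NormedSpace ℂ E]

/-- The linear map `s I - A : D(A) → E`. -/
def shift (A : E →ₗ.[ℂ] E) (s : ℂ) : A.domain →ₗ[ℂ] E :=
  s • A.domain.subtype - A.toFun

/-- The resolvent set of `A`: all `s` such that `s I - A : D(A) → E` is bijective. -/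
def resolventSet (A : E →ₗ.[ℂ] E) : Set ℂ :=
  {s | Function.Bijective (A.shift s)}

/-- The spectrum of `A`. -/
def spectrum (A : E →ₗ.[ℂ] E) : Set ℂ := (A.resolventSet)ᶜ

/-- The part of the spectrum in the closed right half-plane. -/
def unstableSpectrum (A : E →ₗ.[ℂ] E) : Set ℂ := A.spectrum ∩ {s | 0 ≤ s.re}

/-- The part of the spectrum in the open left half-plane. -/
def stableSpectrum (A : E →ₗ.[ℂ] E) : Set ℂ := A.spectrum ∩ {s | s.re < 0}

/-- `R` is a bounded two-sided inverse of `s I - A : D(A) → E`. -/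
def IsResolventAt (A : E →ₗ.[ℂ] E) (s : ℂ) (R : E →L[ℂ] E) : Prop :=
  (∀ y : E, ∃ x : A.domain, R y = x ∧ A.shift s x = y) ∧
    ∀ x : A.domain, R (A.shift s x) = x

open Classical in
/-- The resolvent operator `(s I - A)⁻¹ ∈ L(E, E)`; it is the inverse of `s I - A` at every
point of the resolvent set if `A` is closed and `E` is complete, see `isResolventAt_resolvent`
(generators are closed). Where there is no bounded inverse, it is `0` by convention. -/
def resolvent (A : E →ₗ.[ℂ] E) (s : ℂ) : E →L[ℂ] E :=
  if h : ∃ R : E →L[ℂ] E, A.IsResolventAt s R then h.choose else 0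

theorem isResolventAt_resolvent [CompleteSpace E] (A : E →ₗ.[ℂ] E) (hA : A.IsClosed) {s : ℂ}
    (hs : s ∈ A.resolventSet) : A.IsResolventAt s (A.resolvent s) := by
  have key : ∃ R : E →L[ℂ] E, A.IsResolventAt s R := by
    let e := LinearEquiv.ofBijective (A.shift s) hs
    let g : E →ₗ[ℂ] E := A.domain.subtype ∘ₗ (e.symm : E →ₗ[ℂ] A.domain)
    have hg : _root_.IsClosed (g.graph : Set (E × E)) := by
      have h1 : (g.graph : Set (E × E)) =
          (fun p : E × E => (p.2, s • p.2 - p.1)) ⁻¹' (A.graph : Set (E × E)) := by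
        ext ⟨y, x⟩
        simp only [SetLike.mem_coe, LinearMap.mem_graph_iff, mem_preimage, LinearPMap.mem_graph_iff]
        constructor
        · rintro rfl
          refine ⟨e.symm y, rfl, ?_⟩
          have h2 : A.shift s (e.symm y) = y := e.apply_symm_apply y
          have h3 : s • ((e.symm y : A.domain) : E) - A (e.symm y) = y := h2
          change A (e.symm y) = s • ((e.symm y : A.domain) : E) - y
          rw [eq_sub_iff_add_eq]
          exact (sub_eq_iff_eq_add'.mp h3).symm
        · rintro ⟨z, rfl, hz⟩
          have h2 : A.shift s z = y := by
            change s • (z : E) - A z = y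
            rw [hz]
            simp
          have h3 : e.symm y = z := by
            rw [LinearEquiv.symm_apply_eq]
            exact h2.symm
          change (z : E) = ((e.symm y : A.domain) : E)
          rw [h3]
      rw [h1]
      exact _root_.IsClosed.preimage (by fun_prop) hA
    refine ⟨⟨g, g.continuous_of_isClosed_graph hg⟩, ?_, ?_⟩
    · intro y
      exact ⟨e.symm y, rfl, e.apply_symm_apply y⟩
    · intro x
      change ((e.symm (e x) : A.domain) : E) = x
      rw [e.symm_apply_apply]
  rw [resolvent, dif_pos key]
  exact key.choose_spec

/-- `lam` is an eigenvalue of `A`. -/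
def IsEigenvalue (A : E →ₗ.[ℂ] E) (lam : ℂ) : Prop :=
  ∃ x : A.domain, x ≠ 0 ∧ A x = lam • (x : E)

/-- An isolated point `lam` of the spectrum has finite order: it is a pole of finite order of the
resolvent, i.e. for some `ν`, the limit of `(s - lam)^ν (s I - A)⁻¹ x` as `s → lam`
exists for every `x`. -/
def HasFiniteOrder (A : E →ₗ.[ℂ] E) (lam : ℂ) : Prop :=
  ∃ ν : ℕ, ∀ x : E, ∃ y : E,
    Tendsto (fun s : ℂ => (s - lam) ^ ν • A.resolvent s x) (𝓝[≠] lam) (𝓝 y)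

/-- The part of `A` in the subspace `V`: the restriction of `A` to those `x ∈ D(A) ∩ V` with
`A x ∈ V` (if `A` maps `D(A) ∩ V` into `V`, this is the restriction of `A` to `D(A) ∩ V`). -/
def partIn (A : E →ₗ.[ℂ] E) (V : Submodule ℂ E) : V →ₗ.[ℂ] V where
  domain :=
    { carrier := {x | ∃ h : (x : E) ∈ A.domain, A ⟨x, h⟩ ∈ V}
      zero_mem' := ⟨A.domain.zero_mem, by
        have h : A (0 : A.domain) ∈ V := by rw [LinearPMap.map_zero]; exact V.zero_mem
        exact h⟩
      add_mem' := by
        rintro x y ⟨hx, hx'⟩ ⟨hy, hy'⟩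
        refine ⟨A.domain.add_mem hx hy, ?_⟩
        have h : A (⟨x, hx⟩ + ⟨y, hy⟩ : A.domain) ∈ V := by
          rw [LinearPMap.map_add]; exact V.add_mem hx' hy'
        exact h
      smul_mem' := by
        rintro c x ⟨hx, hx'⟩
        refine ⟨A.domain.smul_mem c hx, ?_⟩
        have h : A (c • ⟨x, hx⟩ : A.domain) ∈ V := by
          rw [LinearPMap.map_smul]; exact V.smul_mem c hx'
        exact h }
  toFun :=
    { toFun := fun x => ⟨A ⟨x.1, x.2.1⟩, x.2.2⟩
      map_add' := fun x y => Subtype.ext (A.map_add ⟨x.1, x.2.1⟩ ⟨y.1, y.2.1⟩)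
      map_smul' := fun c x => Subtype.ext (A.map_smul c ⟨x.1, x.2.1⟩) }

end LinearPMap

/-! ### Simple closed curves, contour integrals, the spectral projection -/

/-- The contour integral `∫_γ f(s) ds = ∫_0^1 γ'(t) f(γ(t)) dt`. -/
def contourIntegral {F : Type*} [NormedAddCommGroup F] [NormedSpace ℂ F] {a b : ℂ}
    (γ : Path a b) (f : ℂ → F) : F :=
  curveIntegral (fun s => ContinuousLinearMap.toSpanSingleton ℂ (f s)) γ

/-- The interior of a closed curve: the union of the bounded components of its complement. -/
def curveInterior {a : ℂ} (γ : Path a a) : Set ℂ :=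
  {z | z ∈ (range γ)ᶜ ∧ Bornology.IsBounded (connectedComponentIn (range γ)ᶜ z)}

/-- The exterior of a closed curve: the union of the unbounded components of its complement. -/
def curveExterior {a : ℂ} (γ : Path a a) : Set ℂ :=
  {z | z ∈ (range γ)ᶜ ∧ ¬ Bornology.IsBounded (connectedComponentIn (range γ)ᶜ z)}

/-- `γ` traverses a rectifiable simple closed curve once, in the positive direction. Every
rectifiable curve has a Lipschitz parametrization (proportional to arc length), and it is such a
parametrization that is used, so that the contour integral is given by the derivative of `γ`,
which exists almost everywhere. -/
structure IsRectifiableJordanCurve {a : ℂ} (γ : Path a a) : Prop where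
  rectifiable : ∃ K : NNReal, LipschitzWith K γ
  simple : ∀ s t : unitInterval, s < t → γ s = γ t → s = 0 ∧ t = 1
  positive : ∀ w ∈ curveInterior γ,
    contourIntegral γ (fun s => (s - w)⁻¹) = 2 * Real.pi * Complex.I

/-- `A` satisfies the spectral decomposition assumption with the curve `γ`: the unstable spectrum
is bounded, and the rectifiable simple closed curve `γ` has the unstable spectrum in its interior
and the stable spectrum in its exterior. -/
structure SpectralDecomposition {E : Type*} [NormedAddCommGroup E] [NormedSpace ℂ E]
    (A : E →ₗ.[ℂ] E) {a : ℂ} (γ : Path a a) : Prop where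
  bounded : Bornology.IsBounded A.unstableSpectrum
  curve : IsRectifiableJordanCurve γ
  unstable_subset : A.unstableSpectrum ⊆ curveInterior γ
  stable_subset : A.stableSpectrum ⊆ curveExterior γ

/-- The spectral projection `(2πi)⁻¹ ∫_γ (s I - A)⁻¹ ds`. -/
def spectralProjection {E : Type*} [NormedAddCommGroup E] [NormedSpace ℂ E]
    (A : E →ₗ.[ℂ] E) {a : ℂ} (γ : Path a a) : E →L[ℂ] E :=
  (2 * Real.pi * Complex.I)⁻¹ • contourIntegral γ (fun s => A.resolvent s)

/-- The unstable subspace: the range of the spectral projection. -/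
def unstableSubspace {E : Type*} [NormedAddCommGroup E] [NormedSpace ℂ E]
    (A : E →ₗ.[ℂ] E) {a : ℂ} (γ : Path a a) : Submodule ℂ E :=
  (spectralProjection A γ : E →ₗ[ℂ] E).range

/-- The stable subspace: the range of the complementary projection. -/
def stableSubspace {E : Type*} [NormedAddCommGroup E] [NormedSpace ℂ E]
    (A : E →ₗ.[ℂ] E) {a : ℂ} (γ : Path a a) : Submodule ℂ E :=
  (ContinuousLinearMap.id ℂ E - spectralProjection A γ : E →ₗ[ℂ] E).range

/-- The assumptions on the decomposition of `A` along the curve `γ`: the spectral decomposition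
assumption holds, the stable part `A_s` is exponentially stable, the unstable spectrum consists of
finitely many eigenvalues of finite order, and the two spectral subspaces are orthogonal. -/
structure OrthogonalSpectralDecomposition {X : Type*} [NormedAddCommGroup X]
    [InnerProductSpace ℂ X] (A : X →ₗ.[ℂ] X) {a : ℂ} (γ : Path a a) : Prop where
  decomposition : SpectralDecomposition A γ
  stable_part : IsExponentiallyStable (A.partIn (stableSubspace A γ))
  finite_unstable : A.unstableSpectrum.Finite
  eigenvalue : ∀ lam ∈ A.unstableSpectrum, A.IsEigenvalue lam
  finite_order : ∀ lam ∈ A.unstableSpectrum, A.HasFiniteOrder lam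
  orthogonal : ∀ xu ∈ unstableSubspace A γ, ∀ xs ∈ stableSubspace A γ, inner ℂ xu xs = 0

/-- `⟨(C* C - A* P - P A) x, x⟩ ≥ m ‖x‖²` for all `x ∈ D(A)`, for some `m > 0`; this includes that
`P` maps `D(A)` into `D(A*)`, so that the operator on the left is defined on `D(A)`. The operator
`A` is meant to be densely defined (as generators are), and `P` self-adjoint, which makes the
inner product on the left real. -/
def IsEllipticOnDomain {X Y : Type*} [NormedAddCommGroup X] [InnerProductSpace ℂ X]
    [CompleteSpace X] [NormedAddCommGroup Y] [InnerProductSpace ℂ Y] [CompleteSpace Y]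
    (A : X →ₗ.[ℂ] X) (C : X →L[ℂ] Y) (P : X →L[ℂ] X) : Prop :=
  ∃ m : ℝ, 0 < m ∧ ∀ x : A.domain, ∃ hx : P x ∈ A.adjoint.domain,
    m * ‖(x : X)‖ ^ 2 ≤
      (inner ℂ (C.adjoint (C x) - A.adjoint ⟨P x, hx⟩ - P (A x)) (x : X)).re

end

/-! Detectability yields `L` such that `B = A + LC` generates an exponentially stable semigroup `S`.
Its Gramian `G = ∫ S(t)* S(t) dt` is bounded, self-adjoint and positive, and satisfies `B*G + GB =
-I` weakly on `D(A)`. Expanding `B` puts `Gx` in `D(A*)` and gives `-A*G - GA = I + GLC + (LC)*G`.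
For `P = cG` the form is therefore `‖Cx‖² + c‖x‖² + 2c Re⟨GLCx, x⟩`. The cross term is at most
`2c‖GL‖‖Cx‖‖x‖`, which a small `c > 0` lets the two squares absorb, leaving `(c/2)‖x‖²`. Density of
`D(A)` makes `A*` single-valued. -/

open MeasureTheory

/-! ### Orbits and generators of strongly continuous semigroups -/

section Semigroup

variable {E : Type*} [NormedAddCommGroup E] [NormedSpace ℂ E]

/-- `T` is arbitrary at negative times; freezing the orbit at its initial value there lets two-sided
calculus apply at `0`. -/
theorem IsC0Semigroup.continuous_comp_max {T : ℝ → E →L[ℂ] E} (hT : IsC0Semigroup T) (x : E) :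
    Continuous fun t : ℝ => T (max t 0) x :=
  (hT.continuousOn x).comp_continuous (continuous_id.max continuous_const)
    fun t => mem_Ici.2 (le_max_right t 0)

theorem tendsto_slope_of_hasDerivWithinAt {f : ℝ → E} {f' : E} {t : ℝ}
    (h : HasDerivWithinAt f f' (Ioi t) t) :
    Tendsto (fun u : ℝ => ((u : ℂ)⁻¹) • (f (t + u) - f t)) (𝓝[>] 0) (𝓝 f') := by
  have h1 := (hasDerivWithinAt_iff_tendsto_slope' (by simp)).1 h
  have h2 : Tendsto (fun u : ℝ => t + u) (𝓝[>] 0) (𝓝[>] t) := by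
    refine tendsto_nhdsWithin_iff.2 ⟨?_, ?_⟩
    · have : Tendsto (fun u : ℝ => t + u) (𝓝 0) (𝓝 (t + 0)) := tendsto_id.const_add t
      rw [add_zero] at this
      exact this.mono_left nhdsWithin_le_nhds
    · filter_upwards [self_mem_nhdsWithin] with u hu
      exact lt_add_of_pos_right t hu
  refine (h1.comp h2).congr fun u => ?_
  simp only [Function.comp_apply, slope, vsub_eq_sub, add_sub_cancel_left]
  rw [← Complex.ofReal_inv, Complex.coe_smul]

/-- The domain of the generator of a strongly continuous semigroup is dense. -/
theorem IsGenerator.dense_domain [CompleteSpace E] {A : E →ₗ.[ℂ] E} {T : ℝ → E →L[ℂ] E}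
    (hA : IsGenerator A T) (hT : IsC0Semigroup T) : Dense (A.domain : Set E) := by
  intro x
  set f : ℝ → E := fun t => T (max t 0) x with hf
  have hfc : Continuous f := hT.continuous_comp_max x
  set F : ℝ → E := fun t => ∫ s in (0 : ℝ)..t, f s with hF
  have hder : ∀ t, HasDerivAt F (f t) t := fun t =>
    intervalIntegral.integral_hasDerivAt_right (hfc.intervalIntegrable _ _)
      (hfc.stronglyMeasurableAtFilter _ _) hfc.continuousAt
  have hF0 : F 0 = 0 := intervalIntegral.integral_same
  have hf0 : f 0 = x := by simp [hf, hT.map_zero]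
  -- By the semigroup law, `T h` translates the window of integration to `[h, t + h]`.
  have hshift : ∀ t h : ℝ, 0 ≤ t → 0 ≤ h → T h (F t) = F (t + h) - F h := by
    intro t h ht hh
    have h1 : T h (F t) = ∫ s in (0 : ℝ)..t, T h (f s) :=
      ((T h).intervalIntegral_comp_comm (hfc.intervalIntegrable _ _)).symm
    have h2 : ∫ s in (0 : ℝ)..t, T h (f s) = ∫ s in (0 : ℝ)..t, f (s + h) := by
      refine intervalIntegral.integral_congr fun s hs => ?_
      rw [uIcc_of_le ht] at hs
      have h3 : (0 : ℝ) ≤ s := hs.1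
      change T h (T (max s 0) x) = T (max (s + h) 0) x
      rw [max_eq_left h3, max_eq_left (add_nonneg h3 hh), add_comm s h, hT.map_add h s hh h3]
      rfl
    rw [h1, h2, intervalIntegral.integral_comp_add_right, zero_add, hF,
      intervalIntegral.integral_interval_sub_left (hfc.intervalIntegrable _ _)
        (hfc.intervalIntegrable _ _)]
  have hmem : ∀ t : ℝ, 0 ≤ t → F t ∈ A.domain := by
    intro t ht
    -- The difference quotient of the semigroup at `F t` is the slope of `F` at `t` minus its slope
    -- at `0`.
    have h1 : (F t, f t - f 0) ∈ A.graph := by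
      rw [hA]
      have h2 := (tendsto_slope_of_hasDerivWithinAt (hder t).hasDerivWithinAt).sub
        (tendsto_slope_of_hasDerivWithinAt (hder 0).hasDerivWithinAt)
      refine h2.congr' ?_
      filter_upwards [self_mem_nhdsWithin] with h hh
      rw [hshift t h ht (le_of_lt hh), hF0, zero_add, ← smul_sub]
      congr 1
      abel
    exact LinearPMap.mem_domain_of_mem_graph h1
  -- The averages `F h / h` lie in the domain and tend to `x`.
  have hlim := tendsto_slope_of_hasDerivWithinAt (hder 0).hasDerivWithinAt
  rw [hf0] at hlim
  refine mem_closure_of_tendsto hlim ?_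
  filter_upwards [self_mem_nhdsWithin] with h hh
  rw [hF0, sub_zero, zero_add]
  exact A.domain.smul_mem _ (hmem h (le_of_lt hh))

/-- The orbits starting in the domain of the generator are right differentiable. -/
theorem IsGenerator.hasDerivWithinAt {A : E →ₗ.[ℂ] E} {T : ℝ → E →L[ℂ] E}
    (hA : IsGenerator A T) (hT : IsC0Semigroup T) (x : A.domain) {t : ℝ} (ht : 0 ≤ t) :
    HasDerivWithinAt (fun s : ℝ => T s (x : E)) (T t (A x)) (Ioi t) t := by
  rw [hasDerivWithinAt_iff_tendsto_slope' (by simp)]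
  have h1 := ((T t).continuous.tendsto (A x)).comp ((hA x (A x)).1 (A.mem_graph x))
  have h2 : Tendsto (fun s : ℝ => s - t) (𝓝[>] t) (𝓝[>] 0) := by
    refine tendsto_nhdsWithin_iff.2 ⟨?_, ?_⟩
    · have : Tendsto (fun s : ℝ => s - t) (𝓝 t) (𝓝 (t - t)) := tendsto_id.sub_const t
      rw [sub_self] at this
      exact this.mono_left nhdsWithin_le_nhds
    · filter_upwards [self_mem_nhdsWithin] with s hs
      exact sub_pos.2 (mem_Ioi.1 hs)
  refine (h1.comp h2).congr' ?_
  filter_upwards [self_mem_nhdsWithin] with s hs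
  have h3 : T s (x : E) = T t (T (s - t) x) := by
    rw [← ContinuousLinearMap.comp_apply, ← hT.map_add t (s - t) ht (sub_pos.2 (mem_Ioi.1 hs)).le,
      add_sub_cancel]
  simp only [Function.comp_apply, slope, vsub_eq_sub]
  rw [map_smul, map_sub, ← h3, ← Complex.ofReal_inv, Complex.coe_smul]

end Semigroup

/-! ### The Gramian of an exponentially stable semigroup -/

section Gramian

variable {X : Type*} [NormedAddCommGroup X] [InnerProductSpace ℂ X]

theorem IsC0Semigroup.continuousOn_inner {S : ℝ → X →L[ℂ] X} (hS : IsC0Semigroup S) (x y : X) :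
    ContinuousOn (fun t : ℝ => inner ℂ (S t x) (S t y)) (Ici 0) :=
  (hS.continuousOn x).inner (𝕜 := ℂ) (hS.continuousOn y)

theorem norm_inner_orbits_le {S : ℝ → X →L[ℂ] X} {M ω : ℝ}
    (hM : ∀ t : ℝ, 0 ≤ t → ‖S t‖ ≤ M * Real.exp (-ω * t)) (x y : X) {t : ℝ} (ht : 0 ≤ t) :
    ‖inner ℂ (S t x) (S t y)‖ ≤ M ^ 2 * ‖x‖ * ‖y‖ * Real.exp (-(2 * ω) * t) := by
  have h1 : ∀ z : X, ‖S t z‖ ≤ M * Real.exp (-ω * t) * ‖z‖ := fun z =>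
    (S t).le_of_opNorm_le (hM t ht) z
  have h2 : Real.exp (-(2 * ω) * t) = Real.exp (-ω * t) * Real.exp (-ω * t) := by
    rw [← Real.exp_add]
    congr 1
    ring
  calc ‖inner ℂ (S t x) (S t y)‖ ≤ ‖S t x‖ * ‖S t y‖ := norm_inner_le_norm _ _
    _ ≤ (M * Real.exp (-ω * t) * ‖x‖) * (M * Real.exp (-ω * t) * ‖y‖) :=
      mul_le_mul (h1 x) (h1 y) (norm_nonneg _) ((norm_nonneg _).trans (h1 x))
    _ = M ^ 2 * ‖x‖ * ‖y‖ * Real.exp (-(2 * ω) * t) := by rw [h2]; ring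

theorem IsC0Semigroup.integrableOn_inner {S : ℝ → X →L[ℂ] X} (hS : IsC0Semigroup S) {M ω : ℝ}
    (hω : 0 < ω) (hM : ∀ t : ℝ, 0 ≤ t → ‖S t‖ ≤ M * Real.exp (-ω * t)) (x y : X) :
    IntegrableOn (fun t : ℝ => inner ℂ (S t x) (S t y)) (Ioi 0) := by
  refine Integrable.mono'
    ((exp_neg_integrableOn_Ioi 0 (mul_pos two_pos hω)).const_mul (M ^ 2 * ‖x‖ * ‖y‖))
    (((hS.continuousOn_inner x y).mono Ioi_subset_Ici_self).aestronglyMeasurable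
      measurableSet_Ioi) ?_
  filter_upwards [ae_restrict_mem measurableSet_Ioi] with t ht
  exact norm_inner_orbits_le hM x y (le_of_lt ht)

/-- An exponentially stable semigroup `S` has a Gramian `G = ∫ (S t)* (S t) dt` over `[0, ∞)`. -/
theorem IsC0Semigroup.exists_gramian [CompleteSpace X] {S : ℝ → X →L[ℂ] X} (hS : IsC0Semigroup S) {M ω : ℝ}
    (hω : 0 < ω) (hM : ∀ t : ℝ, 0 ≤ t → ‖S t‖ ≤ M * Real.exp (-ω * t)) :
    ∃ G : X →L[ℂ] X, ∀ x y : X,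
      inner ℂ (G x) y = ∫ t in Ioi (0 : ℝ), inner ℂ (S t x) (S t y) := by
  have hint := hS.integrableOn_inner hω hM
  let b : X →ₗ⋆[ℂ] X →ₗ[ℂ] ℂ := LinearMap.mk₂'ₛₗ (starRingEnd ℂ) (RingHom.id ℂ)
    (fun x y => ∫ t in Ioi (0 : ℝ), inner ℂ (S t x) (S t y))
    (fun x x' y => by
      simp only [_root_.map_add, inner_add_left]
      exact integral_add (hint x y) (hint x' y))
    (fun c x y => by
      simp only [map_smul, inner_smul_left]
      exact integral_const_mul _ _)
    (fun x y y' => by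
      simp only [_root_.map_add, inner_add_right]
      exact integral_add (hint x y) (hint x y'))
    (fun c x y => by
      simp only [map_smul, inner_smul_right, smul_eq_mul, RingHom.id_apply]
      exact integral_const_mul _ _)
  have hb : ∀ x y, ‖b x y‖ ≤
      (M ^ 2 * ∫ t in Ioi (0 : ℝ), Real.exp (-(2 * ω) * t)) * ‖x‖ * ‖y‖ := by
    intro x y
    have h1 : ‖b x y‖ ≤
        ∫ t in Ioi (0 : ℝ), M ^ 2 * ‖x‖ * ‖y‖ * Real.exp (-(2 * ω) * t) := by
      refine norm_integral_le_of_norm_le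
        ((exp_neg_integrableOn_Ioi 0 (mul_pos two_pos hω)).const_mul _) ?_
      filter_upwards [ae_restrict_mem measurableSet_Ioi] with t ht
      exact norm_inner_orbits_le hM x y (le_of_lt ht)
    rw [integral_const_mul] at h1
    exact h1.trans_eq (by ring)
  -- Riesz representation of the bounded sesquilinear form `b`.
  refine ⟨InnerProductSpace.continuousLinearMapOfBilin (b.mkContinuous₂ _ hb), fun x y => ?_⟩
  rw [InnerProductSpace.continuousLinearMapOfBilin_apply]
  rfl

variable {S : ℝ → X →L[ℂ] X} {G : X →L[ℂ] X}

theorem isSelfAdjoint_gramian [CompleteSpace X]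
    (hG : ∀ x y : X, inner ℂ (G x) y = ∫ t in Ioi (0 : ℝ), inner ℂ (S t x) (S t y)) :
    IsSelfAdjoint G := by
  rw [ContinuousLinearMap.isSelfAdjoint_iff_isSymmetric]
  intro x y
  change inner ℂ (G x) y = inner ℂ x (G y)
  rw [← inner_conj_symm x (G y), hG, hG, ← integral_conj]
  simp only [inner_conj_symm]

/-- The integrand is `‖S t x‖²`, nonzero on some `[0, δ)` by strong continuity at `0`. No uniform
lower bound is obtained or needed. -/
theorem re_inner_gramian_pos (hS : IsC0Semigroup S) {M ω : ℝ} (hω : 0 < ω)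
    (hM : ∀ t : ℝ, 0 ≤ t → ‖S t‖ ≤ M * Real.exp (-ω * t))
    (hG : ∀ x y : X, inner ℂ (G x) y = ∫ t in Ioi (0 : ℝ), inner ℂ (S t x) (S t y))
    {x : X} (hx : x ≠ 0) : 0 < (inner ℂ (G x) x).re := by
  have hint := hS.integrableOn_inner hω hM x x
  have h1 : (inner ℂ (G x) x).re = ∫ t in Ioi (0 : ℝ), ‖S t x‖ ^ 2 := by
    rw [hG]
    refine (integral_re hint).symm.trans ?_
    refine integral_congr_ae (Eventually.of_forall fun t => ?_)
    exact inner_self_eq_norm_sq (𝕜 := ℂ) (S t x)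
  have hint' : IntegrableOn (fun t : ℝ => ‖S t x‖ ^ 2) (Ioi 0) := by
    refine hint.re.congr (Eventually.of_forall fun t => ?_)
    exact inner_self_eq_norm_sq (𝕜 := ℂ) (S t x)
  rw [h1, setIntegral_pos_iff_support_of_nonneg_ae (Eventually.of_forall fun t => sq_nonneg _)
    hint']
  have h2 : ∀ᶠ t in 𝓝[≥] (0 : ℝ), S t x ≠ 0 := by
    refine (hS.continuousOn x 0 self_mem_Ici).eventually_ne ?_
    simpa [hS.map_zero] using hx
  obtain ⟨δ, hδ, hsub⟩ := mem_nhdsGE_iff_exists_Ico_subset.1 h2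
  have h3 : Ioo 0 δ ⊆ (Function.support fun t : ℝ => ‖S t x‖ ^ 2) ∩ Ioi 0 := fun t ht =>
    ⟨pow_ne_zero 2 (norm_ne_zero_iff.2 (hsub ⟨ht.1.le, ht.2⟩)), ht.1⟩
  refine lt_of_lt_of_le ?_ (measure_mono h3)
  simpa using hδ

/-- The Lyapunov equation for the Gramian. -/
theorem inner_gramian_lyapunov {B : X →ₗ.[ℂ] X} (hB : IsGenerator B S) (hS : IsC0Semigroup S)
    {M ω : ℝ} (hω : 0 < ω) (hM : ∀ t : ℝ, 0 ≤ t → ‖S t‖ ≤ M * Real.exp (-ω * t))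
    (hG : ∀ x y : X, inner ℂ (G x) y = ∫ t in Ioi (0 : ℝ), inner ℂ (S t x) (S t y))
    (x y : B.domain) :
    inner ℂ (G x) (B y) + inner ℂ (G (B x)) (y : X) = -inner ℂ (x : X) (y : X) := by
  have hint := hS.integrableOn_inner hω hM
  set f : ℝ → ℂ := fun t => inner ℂ (S t x) (S t y) with hf
  set f' : ℝ → ℂ := fun t => inner ℂ (S t x) (S t (B y)) + inner ℂ (S t (B x)) (S t y) with hf'
  have hf'int : IntegrableOn f' (Ioi 0) := (hint _ _).add (hint _ _)
  -- Right derivatives suffice for this form of the fundamental theorem, provided that `f'` is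
  -- integrable.
  have hftc : ∀ t : ℝ, 0 ≤ t → ∫ s in (0 : ℝ)..t, f' s = f t - f 0 := by
    intro t ht
    refine intervalIntegral.integral_eq_sub_of_hasDeriv_right_of_le ht
      ((hS.continuousOn_inner x y).mono Icc_subset_Ici_self) (fun s hs => ?_) ?_
    · exact (hB.hasDerivWithinAt hS x hs.1.le).inner ℂ (hB.hasDerivWithinAt hS y hs.1.le)
    · rw [intervalIntegrable_iff_integrableOn_Ioc_of_le ht]
      exact hf'int.mono_set Ioc_subset_Ioi_self
  have hlim0 : Tendsto f atTop (𝓝 0) := by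
    have h1 : Tendsto (fun t : ℝ => M ^ 2 * ‖(x : X)‖ * ‖(y : X)‖ * Real.exp (-(2 * ω) * t))
        atTop (𝓝 0) := by
      have h2 : Tendsto (fun t : ℝ => Real.exp (-(2 * ω) * t)) atTop (𝓝 0) :=
        Real.tendsto_exp_atBot.comp
          (tendsto_id.const_mul_atTop_of_neg (neg_neg_of_pos (mul_pos two_pos hω)))
      simpa using h2.const_mul (M ^ 2 * ‖(x : X)‖ * ‖(y : X)‖)
    refine squeeze_zero_norm' ?_ h1
    filter_upwards [eventually_ge_atTop 0] with t ht
    exact norm_inner_orbits_le hM x y ht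
  have hlim : Tendsto (fun t : ℝ => f t - f 0) atTop (𝓝 (∫ t in Ioi (0 : ℝ), f' t)) := by
    refine (intervalIntegral_tendsto_integral_Ioi 0 hf'int tendsto_id).congr' ?_
    filter_upwards [eventually_ge_atTop 0] with t ht
    exact hftc t ht
  have h3 : ∫ t in Ioi (0 : ℝ), f' t = 0 - f 0 := tendsto_nhds_unique hlim (hlim0.sub_const _)
  rw [hG, hG, ← integral_add (hint _ _) (hint _ _)]
  refine h3.trans ?_
  simp [hf, hS.map_zero]

end Gramian

/-! ### The scaled Gramian as solution of the Lyapunov inequality -/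

theorem theorem2 {X Y : Type*} [NormedAddCommGroup X] [InnerProductSpace ℂ X] [CompleteSpace X]
    [NormedAddCommGroup Y] [InnerProductSpace ℂ Y] [CompleteSpace Y]
    (A : X →ₗ.[ℂ] X) (T : ℝ → X →L[ℂ] X) (hT : IsC0Semigroup T) (hA : IsGenerator A T)
    (C : X →L[ℂ] Y) {a : ℂ} (γ : Path a a) (hγ : OrthogonalSpectralDecomposition A γ)
    (hC : IsExponentiallyDetectable A C) :
    ∃ P : X →L[ℂ] X, IsSelfAdjoint P ∧ (∀ x : X, x ≠ 0 → 0 < (inner ℂ (P x) x).re) ∧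
      IsEllipticOnDomain A C P := by
  obtain ⟨L, S, hS, hB, M, ω, hω, hM⟩ := hC
  obtain ⟨G, hG⟩ := hS.exists_gramian hω hM
  have hdense : Dense (A.domain : Set X) := hA.dense_domain hT
  have hlyap : ∀ x y : A.domain, inner ℂ (G x) (L (C y) + A y)
      + inner ℂ (G (L (C x) + A x)) (y : X) = -inner ℂ (x : X) (y : X) :=
    fun x y => inner_gramian_lyapunov hB hS hω hM hG x y
  set K : ℝ := ‖G.comp L‖
  -- Small enough that `c K² ≤ 1/2`; the `+ 1` covers `K = 0`.
  set c : ℝ := (2 * (K ^ 2 + 1))⁻¹ with hc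
  have hc0 : 0 < c := by positivity
  have hcK : c * K ^ 2 ≤ 1 / 2 := by
    rw [hc, inv_mul_le_iff₀ (by positivity)]
    linarith
  have hre : ∀ x y : X, (inner ℂ (((c : ℂ) • G) x) y).re = c * (inner ℂ (G x) y).re := by
    intro x y
    rw [smul_apply, inner_smul_left, Complex.conj_ofReal, Complex.re_ofReal_mul]
  refine ⟨(c : ℂ) • G, ?_, fun x hx => ?_, c / 2, half_pos hc0, fun x => ?_⟩
  · exact IsSelfAdjoint.smul (r := (c : ℂ)) (Complex.conj_ofReal c) (isSelfAdjoint_gramian hG)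
  · rw [hre]
    exact mul_pos hc0 (re_inner_gramian_pos hS hω hM hG hx)
  -- The value of `A* P x`, obtained by solving the Lyapunov identity for `⟨Gx, Ay⟩`.
  set w : X := (c : ℂ) • (-(x : X) - G (L (C x) + A x) - (L.comp C).adjoint (G x)) with hw
  have hadj : ∀ y : A.domain, inner ℂ w (y : X) = inner ℂ (((c : ℂ) • G) x) (A y) := by
    intro y
    have h1 := hlyap x y
    rw [inner_add_right] at h1
    rw [hw, smul_apply, inner_smul_left, inner_smul_left, inner_sub_left, inner_sub_left,
      inner_neg_left, ContinuousLinearMap.adjoint_inner_left, ContinuousLinearMap.comp_apply]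
    congr 1
    linear_combination -h1
  have hmem : ((c : ℂ) • G) x ∈ A.adjoint.domain := A.mem_adjoint_domain_of_exists _ ⟨w, hadj⟩
  refine ⟨hmem, ?_⟩
  rw [LinearPMap.adjoint_apply_eq hdense ⟨_, hmem⟩ hadj]
  have h1 : (inner ℂ (C.adjoint (C x) - w - ((c : ℂ) • G) (A x)) (x : X)).re
      = ‖C x‖ ^ 2 + c * (‖(x : X)‖ ^ 2 + 2 * (inner ℂ (G (L (C x))) (x : X)).re) := by
    have h2 : (inner ℂ (C.adjoint (C x)) (x : X)).re = ‖C x‖ ^ 2 := by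
      rw [ContinuousLinearMap.adjoint_inner_left]
      exact inner_self_eq_norm_sq (𝕜 := ℂ) (C x)
    have h3 : (inner ℂ ((L.comp C).adjoint (G x)) (x : X)).re
        = (inner ℂ (G (L (C x))) (x : X)).re := by
      rw [ContinuousLinearMap.adjoint_inner_left, ContinuousLinearMap.comp_apply]
      have h4 := (isSelfAdjoint_gramian hG).isSymmetric (L (C x)) (x : X)
      change inner ℂ (G (L (C x))) (x : X) = inner ℂ (L (C x)) (G x) at h4
      rw [h4]
      exact inner_re_symm (𝕜 := ℂ) _ _
    have h5 : (inner ℂ (x : X) (x : X)).re = ‖(x : X)‖ ^ 2 :=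
      inner_self_eq_norm_sq (𝕜 := ℂ) (x : X)
    rw [inner_sub_left, inner_sub_left, Complex.sub_re, Complex.sub_re, h2, hre, hw,
      inner_smul_left, Complex.conj_ofReal, Complex.re_ofReal_mul, inner_sub_left, inner_sub_left,
      inner_neg_left, Complex.sub_re, Complex.sub_re, Complex.neg_re, h3, h5, map_add,
      inner_add_left, Complex.add_re]
    ring
  rw [h1]
  have h6 : |(inner ℂ (G (L (C x))) (x : X)).re| ≤ K * ‖C x‖ * ‖(x : X)‖ :=
    (Complex.abs_re_le_norm _).trans <| (norm_inner_le_norm _ _).trans <|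
      mul_le_mul_of_nonneg_right ((G.comp L).le_opNorm (C x)) (norm_nonneg _)
  have h7 := mul_le_mul_of_nonneg_left (neg_le_of_abs_le h6) hc0.le
  have h8 : c * (c * K ^ 2) * ‖(x : X)‖ ^ 2 ≤ c * (1 / 2) * ‖(x : X)‖ ^ 2 := by gcongr
  -- Completing the square in `‖C x‖` leaves `c (1 - c K²) ‖x‖²`, which is at least `(c / 2) ‖x‖²`.
  nlinarith [sq_nonneg (‖C x‖ - c * K * ‖(x : X)‖)]
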